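/- Let $c_1,\dots,c_S$ be candidate modulation formats. Each is a finite constellation $\mathcal C_i\subset\mathbb C$ of $M_i$ distinct, equally likely symbols with unit average power $\frac1{M_i}\sum_{z\in\mathcal C_i}|z|^2=1$, and is either of PSK type, $\mathcal C_i=\{e^{j(\varphi_i+2\pi m/M_i)}:0\le m<M_i\}$ for some fixed rotation $\varphi_i$, or of QAM type, $\mathcal C_i=\{b_me^{j\theta_m}:0\le m<M_i\}$ with at least two different amplitudes $b_m$. Two different candidates differ in type (PSK/QAM) or in the number of symbols. Fix $N_0>0$ (known), $\Gamma>0$ and $N>1$. Sensors $l=1,\dots,L$ observe non-overlapping windows of the same transmitted symbol sequence $(I_k)$: sensor $l$ observes $$r_{l,n}=a_le^{j\theta_l}I_{k_{l,n}}+w_{l,n},\qquad n=1,\dots,N,$$ where the indices $k_{l,n}$ are all distinct. Under hypothesis $H_i$ the $I_k$ are i.i.d. uniform on $\mathcal C_i$, the $a_l$ are i.i.d. Rayleigh with $E[a_l^2]=\Gamma$, the $\theta_l$ are i.i.d. uniform on $[-\pi,\pi]$, the $w_{l,n}$ are i.i.d. $\mathcal{CN}(0,N_0)$, and all of these are independent.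 Write $\mathbf r_l=(r_{l,1},\dots,r_{l,N})$. The marginal likelihood of an observation vector $\mathbf r\in\mathbb C^N$ under $H_i$ is $$p_A(\mathbf r|H_i)=E_{a,\theta,\mathbf I}\Big[\frac1{(\pi N_0)^N}\exp\Big(-\frac1{N_0}\sum_{n=1}^N|r_n-ae^{j\theta}I_n|^2\Big)\Big],$$ where $a$ is Rayleigh with $E[a^2]=\Gamma$, $\theta$ is uniform on $[-\pi,\pi]$, $\mathbf I=(I_1,\dots,I_N)$ is uniform on $\mathcal C_i^N$, and the three are independent. Then: (1) for every $i$ and every $\mathbf r\in\mathbb C^N$, $$p_A(\mathbf r|H_i)=\frac1{(\pi N_0)^N}\,E_{\mathbf I}\left\{\frac1{1+\frac{\Gamma}{N_0}\|\mathbf I\|^2}\exp\left(\frac{\frac{\Gamma}{N_0^2}|\mathbf I^H\mathbf r|^2}{1+\frac{\Gamma}{N_0}\|\mathbf I\|^2}-\frac{\|\mathbf r\|^2}{N_0}\right)\right\};$$ (2) the fusion-center maximum likelihood classifier $\hat\imath=\arg\min_i\Lambda_i$, $\Lambda_i=-\frac1L\log\prod_{l=1}^Lp_A(\mathbf r_l|H_i)$,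 has average error probability $$P_e=\frac1S\sum_{i=1}^S\big(1-P(\Lambda_i<\Lambda_j\ \text{for all}\ j\ne i\mid H_i)\big)\longrightarrow0\qquad(L\to\infty).$$ -/

import Mathlib

open MeasureTheory ProbabilityTheory Filter Topology

noncomputable section

namespace ModClass

/-- The two families of linear digital modulations. -/
inductive Family
  | psk
  | qam

/-- `M`-PSK constellation: the `M`-th roots of unity, up to a fixed rotation `φ`. -/
def IsPSK (pts : Finset ℂ) : Prop :=
  ∃ φ : ℝ, ∀ z : ℂ, z ∈ pts ↔ ∃ m < pts.card,
    z = Complex.exp (((φ + 2 * Real.pi * m / pts.card : ℝ) : ℂ) * Complex.I)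

/-- `M`-QAM constellation `{b_m exp (j θ_m)}`: the phases and the amplitudes of the symbols are
arbitrary, but there are at least two different amplitudes. -/
def IsQAM (pts : Finset ℂ) : Prop :=
  ∃ z ∈ pts, ∃ w ∈ pts, ‖z‖ ≠ ‖w‖

/-- A candidate modulation format: a finite constellation of unit average power which is of PSK
or of QAM type. Its symbols are equally likely. -/
structure Modulation where
  family : Family
  points : Finset ℂ
  unit_power : (∑ z ∈ points, ‖z‖ ^ 2) / (points.card : ℝ) = 1
  shape : match family with
    | Family.psk => IsPSK points
    | Family.qam => IsQAM points

/-- The number `M` of constellation symbols. -/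
def Modulation.order (c : Modulation) : ℕ := c.points.card

/-- The law of one symbol: uniform on the constellation. -/
def Modulation.symbolLaw (c : Modulation) : Measure ℂ := uniformOn (c.points : Set ℂ)

/-- The Rayleigh law with second moment `Γ`. -/
def rayleighLaw (Γ : ℝ) : Measure ℝ :=
  (volume.restrict (Set.Ici 0)).withDensity
    fun a => ENNReal.ofReal (2 * a / Γ * Real.exp (-(a ^ 2) / Γ))

/-- The uniform law on `[-π, π]`. -/
def phaseLaw : Measure ℝ := cond volume (Set.Icc (-Real.pi) Real.pi)

/-- The law of the channel parameters `(a, θ)` of one sensor. -/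
def channelLaw (Γ : ℝ) : Measure (ℝ × ℝ) := (rayleighLaw Γ).prod phaseLaw

/-- The circularly symmetric complex Gaussian law `CN(0, N₀)`: independent centred Gaussian
real and imaginary parts of variance `N₀ / 2`. -/
def noiseLaw (N₀ : ℝ) : Measure ℂ :=
  ((gaussianReal 0 (N₀ / 2).toNNReal).prod (gaussianReal 0 (N₀ / 2).toNNReal)).map
    Complex.measurableEquivRealProd.symm

/-- All the random quantities of a system of `L` sensors with `N` observations each: the
transmitted symbol sequence, which is common to all sensors, the channel parameters `(a_l, θ_l)`
of each sensor, and the noise samples of each sensor. -/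
abbrev Sample (L N : ℕ) : Type :=
  (ℕ → ℂ) × (Fin L → ℝ × ℝ) × (Fin L → Fin N → ℂ)

/-- The joint law of the random quantities when the modulation is `c`: everything is
independent, and identically distributed over the time indices and over the sensors. -/
def sampleLaw (c : Modulation) (Γ N₀ : ℝ) (L N : ℕ) : Measure (Sample L N) :=
  (Measure.infinitePi fun _ : ℕ => c.symbolLaw).prod
    ((Measure.pi fun _ : Fin L => channelLaw Γ).prod
      (Measure.pi fun _ : Fin L => Measure.pi fun _ : Fin N => noiseLaw N₀))

/-- The complex channel gain `a exp (j θ)`. -/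
def gain (u : ℝ × ℝ) : ℂ := (u.1 : ℂ) * Complex.exp ((u.2 : ℂ) * Complex.I)

/-- The observation vector `r_l` of sensor `l`, which observes the transmitted symbols with time
indices `win l 0, …, win l (N - 1)`. -/
def received {L N : ℕ} (win : Fin L → Fin N → ℕ) (x : Sample L N) (l : Fin L) : Fin N → ℂ :=
  fun n => gain (x.2.1 l) * x.1 (win l n) + x.2.2 l n

/-- The likelihood of one observation vector given the symbols and the channel parameters. -/
def likelihood (N₀ : ℝ) {N : ℕ} (s : Fin N → ℂ) (u : ℝ × ℝ) (r : Fin N → ℂ) : ℝ :=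
  1 / (Real.pi * N₀) ^ N * Real.exp (-(1 / N₀) * ∑ n, ‖r n - gain u * s n‖ ^ 2)

/-- Expectation over `N` independent equally likely symbols of the constellation of `c`. -/
def Modulation.symbolMean (c : Modulation) {N : ℕ} (f : (Fin N → ℂ) → ℝ) : ℝ :=
  1 / (c.order : ℝ) ^ N * ∑ s ∈ Fintype.piFinset (fun _ : Fin N => c.points), f s

/-- The marginal likelihood of one observation vector: all unknowns (symbols, amplitude and
phase) are averaged out. -/
def marginalLikelihood (c : Modulation) (Γ N₀ : ℝ) {N : ℕ} (r : Fin N → ℂ) : ℝ :=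
  ∫ u, c.symbolMean (fun s => likelihood N₀ s u r) ∂(channelLaw Γ)

/-- The closed form of the marginal likelihood, up to the normalizing constant. -/
def closedForm (c : Modulation) (Γ N₀ : ℝ) {N : ℕ} (r : Fin N → ℂ) : ℝ :=
  c.symbolMean fun s =>
    1 / (1 + Γ / N₀ * ∑ n, ‖s n‖ ^ 2) *
      Real.exp (Γ / N₀ ^ 2 * ‖∑ n, (starRingEnd ℂ) (s n) * r n‖ ^ 2 /
          (1 + Γ / N₀ * ∑ n, ‖s n‖ ^ 2) - (∑ n, ‖r n‖ ^ 2) / N₀)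

/-- The test statistic of the fusion center: the normalized negative logarithm of the product of
the marginal likelihoods of the sensors. -/
def fusionStatistic (c : Modulation) (Γ N₀ : ℝ) {L N : ℕ} (r : Fin L → Fin N → ℂ) : ℝ :=
  -(1 / (L : ℝ)) * Real.log (∏ l, marginalLikelihood c Γ N₀ (r l))

/-- The event that the classifier, which picks the candidate with the smallest statistic (that is,
with the largest product of marginal likelihoods), decides for candidate `i`; ties are not
counted as a decision for `i`. -/
def decides {S : ℕ} (c : Fin S → Modulation) (Γ N₀ : ℝ) {L N : ℕ} (i : Fin S) :
    Set (Fin L → Fin N → ℂ) :=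
  {r | ∀ j, j ≠ i → fusionStatistic (c i) Γ N₀ r < fusionStatistic (c j) Γ N₀ r}

/-- The probability of error when candidate `i` is the true modulation. -/
def condErrorProb {S : ℕ} (c : Fin S → Modulation) (Γ N₀ : ℝ) {L N : ℕ}
    (win : Fin L → Fin N → ℕ) (i : Fin S) : ℝ :=
  1 - (sampleLaw (c i) Γ N₀ L N).real {x | received win x ∈ decides c Γ N₀ i}

/-- The average probability of error, all candidates being equally likely a priori. -/
def errorProb {S : ℕ} (c : Fin S → Modulation) (Γ N₀ : ℝ) {L N : ℕ}
    (win : Fin L → Fin N → ℕ) : ℝ :=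
  1 / (S : ℝ) * ∑ i, condErrorProb c Γ N₀ win i

end ModClass

end

/-! Closed form: a Rayleigh amplitude with an independent uniform phase is the polar form of a
`CN(0, Γ)` gain (`map_gain_channelLaw`). For fixed symbols the likelihood is the exponential of a
quadratic in the gain, so averaging it is a Gaussian integral (`integral_likelihood`).

Consistency: the windows are disjoint, so the sensors' vectors are i.i.d.
(`map_received_sampleLaw`), each with density `marginalLikelihood` (`lintegral_sensorLaw`). Markov's
inequality for the square root of the likelihood ratio bounds the probability that `j` does at least
as well as the true `i` by `ρ ^ L`, where `ρ` is the Bhattacharyya coefficient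
(`sampleLaw_fusionStatistic_le`); a union bound over `j` concludes. It remains to see that `ρ < 1`.
The densities being continuous, it suffices that they differ at one point (`bhattacharyya_lt_one`).

Identifiability: suppose two closed forms agree everywhere. At `√m • r`, for all natural `m`, this
equates all moments of two finite weighted sums of atoms `exp κ_s`, with `κ_s` the correlation of
`s` with `r`, so the weighted laws of `κ_s` agree. For a suitable `r` every non-constant `s` has
`κ_s > N / N₀`, while a constant `s = (z, …, z)` has `κ_s < N / N₀`, a function of `‖z‖` alone.
Hence `M ^ (-N) * ∑ ψ (‖z‖ ^ 2)` is determined for every `ψ` (`sum_energy_eq`): `ψ = 1` gives `M`,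
since `N > 1`, and `ψ v = (v - 1) ^ 2` separates PSK from QAM. -/

noncomputable section

namespace ModClass

/-! ### Gaussian noise, and the channel gain as a complex Gaussian. -/

/-- The density of the circularly symmetric complex Gaussian law `CN(0, v)`. -/
def gaussDensity (v : ℝ) (z : ℂ) : ℝ := 1 / (Real.pi * v) * Real.exp (-(1 / v) * ‖z‖ ^ 2)

lemma gaussDensity_nonneg {v : ℝ} (hv : 0 < v) (z : ℂ) : 0 ≤ gaussDensity v z := by
  unfold gaussDensity
  positivity

@[fun_prop]
lemma continuous_gaussDensity (v : ℝ) : Continuous (gaussDensity v) := by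
  unfold gaussDensity
  fun_prop

lemma noiseLaw_eq_withDensity {v : ℝ} (hv : 0 < v) :
    noiseLaw v = volume.withDensity fun z => ENNReal.ofReal (gaussDensity v z) := by
  have hv2 : (v / 2).toNNReal ≠ 0 := by
    simpa using hv
  have hpres := Complex.volume_preserving_equiv_real_prod
  unfold noiseLaw
  rw [gaussianReal_of_var_ne_zero _ hv2,
    prod_withDensity (measurable_gaussianPDF _ _) (measurable_gaussianPDF _ _)]
  ext s hs
  rw [Measure.map_apply Complex.measurableEquivRealProd.symm.measurable hs,
    withDensity_apply _ (Complex.measurableEquivRealProd.symm.measurable hs),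
    withDensity_apply _ hs, ← Measure.volume_eq_prod,
    ← hpres.symm.setLIntegral_comp_preimage hs (by fun_prop)]
  refine lintegral_congr fun p => ?_
  rw [gaussianPDF, gaussianPDF, ← ENNReal.ofReal_mul (gaussianPDFReal_nonneg _ _ _)]
  congr 1
  have hc : ((v / 2).toNNReal : ℝ) = v / 2 := Real.coe_toNNReal _ (by positivity)
  have hsq : ‖Complex.measurableEquivRealProd.symm p‖ ^ 2 = p.1 ^ 2 + p.2 ^ 2 := by
    rw [← Complex.normSq_eq_norm_sq, Complex.normSq_apply]
    simp [Complex.measurableEquivRealProd_symm_apply, sq]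
  rw [gaussianPDFReal, gaussianPDFReal, gaussDensity, hc, hsq, mul_mul_mul_comm, ← Real.exp_add,
    ← mul_inv, Real.mul_self_sqrt (by positivity)]
  congr 1
  · field_simp
  · congr 1
    field_simp
    ring

instance isProbabilityMeasure_noiseLaw (v : ℝ) : IsProbabilityMeasure (noiseLaw v) := by
  unfold noiseLaw
  exact Measure.isProbabilityMeasure_map Complex.measurableEquivRealProd.symm.measurable.aemeasurable

@[fun_prop]
lemma continuous_gain : Continuous gain := by
  unfold gain
  fun_prop

/-- The open interval is the angular range of `polarCoord.target`; the endpoints are null. -/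
lemma phaseLaw_eq :
    phaseLaw = ENNReal.ofReal (1 / (2 * Real.pi)) •
      volume.restrict (Set.Ioo (-Real.pi) Real.pi) := by
  have hpi := Real.pi_pos
  unfold phaseLaw ProbabilityTheory.cond
  rw [Real.volume_Icc, Measure.restrict_congr_set (Ioo_ae_eq_Icc (a := -Real.pi)).symm,
    ← ENNReal.ofReal_inv_of_pos (by linarith)]
  congr 2
  rw [one_div]
  congr 1
  ring

instance isProbabilityMeasure_phaseLaw : IsProbabilityMeasure phaseLaw := by
  have hpi := Real.pi_pos
  unfold phaseLaw
  exact cond_isProbabilityMeasure_of_finite (by simp [Real.volume_Icc, hpi]) (by simp)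

instance sFinite_rayleighLaw (Γ : ℝ) : SFinite (rayleighLaw Γ) := by
  unfold rayleighLaw
  infer_instance

/-- In polar coordinates the channel gain is circularly symmetric complex Gaussian. -/
lemma lintegral_channelLaw {Γ : ℝ} (hΓ : 0 < Γ) {f : ℂ → ENNReal} (hf : Measurable f) :
    ∫⁻ u, f (gain u) ∂(channelLaw Γ) = ∫⁻ h, f h ∂(noiseLaw Γ) := by
  have hpi := Real.pi_pos
  have hR : Measurable fun a : ℝ => ENNReal.ofReal (2 * a / Γ * Real.exp (-(a ^ 2) / Γ)) := by
    fun_prop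
  have hR2 : Measurable fun z : ℝ × ℝ =>
      ENNReal.ofReal (2 * z.1 / Γ * Real.exp (-(z.1 ^ 2) / Γ)) := by
    fun_prop
  have hG : Measurable fun z : ℂ => ENNReal.ofReal (gaussDensity Γ z) := by fun_prop
  have hfg : Measurable fun u => f (gain u) := hf.comp (by fun_prop)
  rw [noiseLaw_eq_withDensity hΓ, lintegral_withDensity_eq_lintegral_mul _ hG hf,
    ← Complex.lintegral_comp_polarCoord_symm, channelLaw, phaseLaw_eq, rayleighLaw,
    Measure.prod_smul_right, lintegral_smul_measure, prod_withDensity_left hR,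
    lintegral_withDensity_eq_lintegral_mul _ (by fun_prop) hfg,
    Measure.restrict_congr_set (Ioi_ae_eq_Ici (a := (0 : ℝ))).symm, Measure.prod_restrict,
    ← Measure.volume_eq_prod,
    show polarCoord.target = Set.Ioi (0 : ℝ) ×ˢ Set.Ioo (-Real.pi) Real.pi from rfl, smul_eq_mul,
    ← lintegral_const_mul _ (hR2.mul hfg)]
  refine setLIntegral_congr_fun (measurableSet_Ioi.prod measurableSet_Ioo) fun p hp => ?_
  have hp1 : 0 < p.1 := hp.1
  have hgain : Complex.polarCoord.symm p = gain p := by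
    rw [Complex.polarCoord_symm_apply, gain, Complex.exp_mul_I, Complex.ofReal_cos,
      Complex.ofReal_sin]
  have hnorm : ‖gain p‖ = p.1 := by
    rw [gain, norm_mul, Complex.norm_exp_ofReal_mul_I, mul_one, Complex.norm_real,
      Real.norm_of_nonneg hp1.le]
  simp only [hgain, Pi.mul_apply, smul_eq_mul, gaussDensity, hnorm]
  -- With `a = p.1`, the densities match: `1/(2π) * (2a/Γ) * exp (-a²/Γ) = a * (1/(πΓ)) * exp
  -- (-a²/Γ)`, where the leading `a` on the right is the polar Jacobian.
  rw [← mul_assoc, ← mul_assoc, ← ENNReal.ofReal_mul (by positivity), ← ENNReal.ofReal_mul hp1.le]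
  congr 2
  rw [show -(1 / Γ) * p.1 ^ 2 = -(p.1 ^ 2) / Γ by ring]
  field_simp

lemma map_gain_channelLaw {Γ : ℝ} (hΓ : 0 < Γ) : (channelLaw Γ).map gain = noiseLaw Γ := by
  ext s hs
  have := lintegral_channelLaw hΓ (measurable_one.indicator hs)
  rw [lintegral_indicator_one hs] at this
  rw [← this, ← lintegral_map (measurable_one.indicator hs) (by fun_prop),
    lintegral_indicator_one hs]

/-- Not an instance: for `Γ ≤ 0` the Rayleigh density vanishes and the measure is zero. -/
lemma isProbabilityMeasure_channelLaw {Γ : ℝ} (hΓ : 0 < Γ) :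
    IsProbabilityMeasure (channelLaw Γ) := by
  have := lintegral_channelLaw hΓ measurable_one
  constructor
  simpa using this

/-! ### Closed form of the marginal likelihood. -/

lemma integral_exp_neg_mul_sq_norm_add {b : ℝ} (hb : 0 < b) (c : ℝ) (w : ℂ) :
    ∫ h : ℂ, Real.exp (-b * ‖h‖ ^ 2 + c * inner ℝ w h) =
      Real.pi / b * Real.exp (c ^ 2 * ‖w‖ ^ 2 / (4 * b)) := by
  have h := GaussianFourier.integral_cexp_neg_mul_sq_norm_add (b := (b : ℂ)) (V := ℂ)
    (by simpa using hb) c w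
  -- The general formula carries `(π / b) ^ (dim / 2)`, and `ℂ` has real dimension 2.
  have hfin : ((Module.finrank ℝ ℂ : ℂ) / 2) = 1 := by
    rw [Complex.finrank_real_complex]
    norm_num
  rw [hfin, Complex.cpow_one] at h
  apply Complex.ofReal_injective
  rw [← integral_complex_ofReal]
  push_cast
  exact h

/-- Separates the parts quadratic and linear in the gain `h`, as the Gaussian integral requires. -/
lemma sum_norm_sub_mul_sq {N : ℕ} (s r : Fin N → ℂ) (h : ℂ) :
    ∑ n, ‖r n - h * s n‖ ^ 2 = ∑ n, ‖r n‖ ^ 2 + (∑ n, ‖s n‖ ^ 2) * ‖h‖ ^ 2 -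
      2 * inner ℝ (∑ n, (starRingEnd ℂ) (s n) * r n) h := by
  rw [sum_inner, Finset.sum_mul, Finset.mul_sum, ← Finset.sum_add_distrib,
    ← Finset.sum_sub_distrib]
  refine Finset.sum_congr rfl fun n _ => ?_
  simp only [← Complex.normSq_eq_norm_sq, Complex.normSq_apply, Complex.inner]
  simp
  ring

lemma integral_likelihood {Γ N₀ : ℝ} (hΓ : 0 < Γ) (hN₀ : 0 < N₀) {N : ℕ} (s r : Fin N → ℂ) :
    ∫ u, likelihood N₀ s u r ∂(channelLaw Γ) = 1 / (Real.pi * N₀) ^ N *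
      (1 / (1 + Γ / N₀ * ∑ n, ‖s n‖ ^ 2) *
      Real.exp (Γ / N₀ ^ 2 * ‖∑ n, (starRingEnd ℂ) (s n) * r n‖ ^ 2 /
          (1 + Γ / N₀ * ∑ n, ‖s n‖ ^ 2) - (∑ n, ‖r n‖ ^ 2) / N₀)) := by
  have hpi := Real.pi_pos
  set A := ∑ n, (starRingEnd ℂ) (s n) * r n
  set X := ∑ n, ‖s n‖ ^ 2 with hX
  have hX0 : 0 ≤ X := Finset.sum_nonneg fun _ _ => by positivity
  set R := ∑ n, ‖r n‖ ^ 2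
  have hb : 0 < 1 / Γ + X / N₀ := by positivity
  have hD : 0 < 1 + Γ / N₀ * X := by positivity
  let F : ℂ → ℝ := fun h =>
    1 / (Real.pi * N₀) ^ N * Real.exp (-(1 / N₀) * ∑ n, ‖r n - h * s n‖ ^ 2)
  have hF : Continuous F := by fun_prop
  have h1 : ∫ u, likelihood N₀ s u r ∂(channelLaw Γ) = ∫ h, F h ∂(noiseLaw Γ) := by
    rw [← map_gain_channelLaw hΓ, integral_map (by fun_prop) hF.aestronglyMeasurable]
    rfl
  rw [h1, noiseLaw_eq_withDensity hΓ, integral_withDensity_eq_integral_toReal_smul (by fun_prop)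
    (by simp)]
  -- The prior density of the gain adds `1 / Γ` to the quadratic coefficient `X / N₀`.
  have h2 : ∀ h : ℂ, (ENNReal.ofReal (gaussDensity Γ h)).toReal • F h =
      (1 / (Real.pi * N₀) ^ N * (1 / (Real.pi * Γ)) * Real.exp (-R / N₀)) *
        Real.exp (-(1 / Γ + X / N₀) * ‖h‖ ^ 2 + 2 / N₀ * inner ℝ A h) := by
    intro h
    rw [ENNReal.toReal_ofReal (gaussDensity_nonneg hΓ h), smul_eq_mul, gaussDensity]
    simp only [F]
    rw [sum_norm_sub_mul_sq, mul_mul_mul_comm, ← Real.exp_add, mul_assoc (_ * _) (Real.exp _),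
      ← Real.exp_add, mul_comm (1 / (Real.pi * Γ))]
    congr 2
    ring
  simp_rw [h2]
  rw [integral_const_mul, integral_exp_neg_mul_sq_norm_add hb, mul_assoc (1 / (Real.pi * N₀) ^ N),
    mul_assoc (1 / (Real.pi * N₀) ^ N), sub_eq_add_neg, Real.exp_add,
    show (2 / N₀) ^ 2 * ‖A‖ ^ 2 / (4 * (1 / Γ + X / N₀)) =
      Γ / N₀ ^ 2 * ‖A‖ ^ 2 / (1 + Γ / N₀ * X) by field_simp; ring, neg_div]
  have : 1 / (Real.pi * Γ) * (Real.pi / (1 / Γ + X / N₀)) = 1 / (1 + Γ / N₀ * X) := by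
    field_simp
  rw [← this]
  ring

lemma continuous_likelihood_channel {N₀ : ℝ} {N : ℕ} (s r : Fin N → ℂ) :
    Continuous fun u => likelihood N₀ s u r := by
  unfold likelihood
  fun_prop

lemma likelihood_nonneg {N₀ : ℝ} (hN₀ : 0 < N₀) {N : ℕ} (s : Fin N → ℂ) (u : ℝ × ℝ)
    (r : Fin N → ℂ) : 0 ≤ likelihood N₀ s u r := by
  have hpi := Real.pi_pos
  unfold likelihood
  positivity

lemma integrable_likelihood {Γ N₀ : ℝ} (hΓ : 0 < Γ) (hN₀ : 0 < N₀) {N : ℕ} (s r : Fin N → ℂ) :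
    Integrable (fun u => likelihood N₀ s u r) (channelLaw Γ) := by
  have := isProbabilityMeasure_channelLaw hΓ
  have hpi := Real.pi_pos
  refine Integrable.of_bound (continuous_likelihood_channel s r).aestronglyMeasurable (1 / (Real.pi * N₀) ^ N) (.of_forall ?_)
  intro u
  rw [Real.norm_of_nonneg (likelihood_nonneg hN₀ s u r)]
  refine mul_le_of_le_one_right (by positivity) (Real.exp_le_one_iff.2 ?_)
  have : 0 ≤ ∑ n, ‖r n - gain u * s n‖ ^ 2 := Finset.sum_nonneg fun _ _ => by positivity
  have h0 : 0 ≤ 1 / N₀ := by positivity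
  nlinarith

lemma marginalLikelihood_eq (c : Modulation) {Γ N₀ : ℝ} (hΓ : 0 < Γ) (hN₀ : 0 < N₀) {N : ℕ}
    (r : Fin N → ℂ) :
    marginalLikelihood c Γ N₀ r = 1 / (Real.pi * N₀) ^ N * closedForm c Γ N₀ r := by
  unfold marginalLikelihood closedForm Modulation.symbolMean
  rw [integral_const_mul, integral_finsetSum _ fun s _ => integrable_likelihood hΓ hN₀ s r]
  simp_rw [integral_likelihood hΓ hN₀, ← Finset.mul_sum]
  ring

/-! ### Density of one sensor's observation vector. -/

lemma Modulation.order_pos (c : Modulation) : 0 < c.order := by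
  rcases Nat.eq_zero_or_pos c.order with h | h
  · have h1 := c.unit_power
    have h2 : c.points.card = 0 := h
    simp [h2] at h1
  · exact h

lemma Modulation.points_nonempty (c : Modulation) : c.points.Nonempty :=
  Finset.card_pos.1 c.order_pos

instance Modulation.isProbabilityMeasure_symbolLaw (c : Modulation) :
    IsProbabilityMeasure c.symbolLaw :=
  isProbabilityMeasure_uniformOn c.points.finite_toSet (by exact_mod_cast c.points_nonempty)

lemma Modulation.symbolLaw_apply (c : Modulation) {A : Set ℂ} (hA : MeasurableSet A) :
    c.symbolLaw A = (c.order : ENNReal)⁻¹ * ∑ z ∈ c.points, Measure.dirac z A := by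
  classical
  have hm : MeasurableSet (c.points : Set ℂ) := c.points.measurableSet
  rw [symbolLaw, uniformOn, cond_apply hm, Measure.count_apply_finset, ← order]
  congr 1
  have : ((c.points : Set ℂ) ∩ A) = ((c.points.filter fun z => z ∈ A : Finset ℂ) : Set ℂ) := by
    ext z
    simp
  rw [this, Measure.count_apply_finset, Finset.card_filter]
  simp [Measure.dirac_apply' _ hA, Set.indicator_apply]

lemma Modulation.pi_symbolLaw (c : Modulation) (N : ℕ) :
    Measure.pi (fun _ : Fin N => c.symbolLaw) = ((c.order : ENNReal)⁻¹ ^ N) •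
      ∑ s ∈ Fintype.piFinset (fun _ : Fin N => c.points), Measure.dirac s := by
  refine Measure.pi_eq fun A hA => ?_
  simp_rw [c.symbolLaw_apply (hA _)]
  rw [Finset.prod_mul_distrib, Finset.prod_const, Finset.card_univ, Fintype.card_fin,
    Finset.prod_univ_sum, Measure.smul_apply, smul_eq_mul, Measure.finsetSum_apply]
  congr 1
  refine Finset.sum_congr rfl fun s _ => ?_
  rw [← Measure.pi_pi, ← Measure.infinitePi_eq_pi, Measure.infinitePi_dirac]

lemma Modulation.lintegral_pi_symbolLaw (c : Modulation) {N : ℕ} (f : (Fin N → ℂ) → ENNReal) :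
    ∫⁻ s, f s ∂(Measure.pi fun _ : Fin N => c.symbolLaw) =
      ((c.order : ENNReal)⁻¹ ^ N) * ∑ s ∈ Fintype.piFinset (fun _ : Fin N => c.points), f s := by
  rw [pi_symbolLaw, lintegral_smul_measure, lintegral_finsetSum_measure, smul_eq_mul]
  simp_rw [lintegral_dirac]

/-- Independence in product form, used both for the density of the noise vector and for the Chernoff
bound across sensors. -/
lemma lintegral_pi_prod_eq_prod {n : ℕ} {E : Type*} [MeasurableSpace E] (μ : Measure E)
    [SigmaFinite μ] (f : Fin n → E → ENNReal) (hf : ∀ i, Measurable (f i)) :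
    ∫⁻ x, ∏ i, f i (x i) ∂(Measure.pi fun _ : Fin n => μ) = ∏ i, ∫⁻ x, f i x ∂μ := by
  induction n with
  | zero => simp
  | succ n ih =>
    have hm : Measurable fun x : Fin n → E => ∏ i : Fin n, f i.succ (x i) :=
      Finset.measurable_prod _ fun i _ => (hf _).comp (measurable_pi_apply i)
    rw [← ((measurePreserving_piFinSuccAbove (fun _ => μ) 0).symm).lintegral_comp_emb
      (MeasurableEquiv.measurableEmbedding _)]
    simp_rw [MeasurableEquiv.piFinSuccAbove_symm_apply, Fin.insertNthEquiv, Equiv.coe_fn_mk,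
      Fin.prod_univ_succ, Fin.insertNth_zero, Fin.cons_succ, Fin.cons_zero, cast_eq]
    rw [lintegral_prod_mul (hf 0).aemeasurable hm.aemeasurable, ih _ fun i => hf _]

lemma pi_noiseLaw {v : ℝ} (hv : 0 < v) (N : ℕ) :
    Measure.pi (fun _ : Fin N => noiseLaw v) =
      volume.withDensity fun w => ENNReal.ofReal (∏ n, gaussDensity v (w n)) := by
  refine Measure.pi_eq fun A hA => ?_
  rw [withDensity_apply _ (MeasurableSet.univ_pi hA),
    ← lintegral_indicator (MeasurableSet.univ_pi hA)]
  have hm : Measurable fun z : ℂ => ENNReal.ofReal (gaussDensity v z) := by fun_prop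
  -- On a box, the indicator times the product density is a product of functions of one coordinate
  -- each.
  have h := lintegral_pi_prod_eq_prod (volume : Measure ℂ)
    (fun i : Fin N => (A i).indicator fun z => ENNReal.ofReal (gaussDensity v z))
    fun i => hm.indicator (hA i)
  rw [← volume_pi] at h
  simp_rw [lintegral_indicator (hA _)] at h
  simp_rw [noiseLaw_eq_withDensity hv, withDensity_apply _ (hA _), ← h]
  refine lintegral_congr fun w => ?_
  by_cases hw : w ∈ Set.univ.pi A
  · rw [Set.indicator_of_mem hw, ENNReal.ofReal_prod_of_nonneg fun i _ => gaussDensity_nonneg hv _]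
    exact Finset.prod_congr rfl fun i _ => (Set.indicator_of_mem (hw i trivial)
      fun z => ENNReal.ofReal (gaussDensity v z)).symm
  · rw [Set.indicator_of_notMem hw]
    obtain ⟨i, hi⟩ : ∃ i, w i ∉ A i := by simpa [Set.mem_univ_pi] using hw
    exact (Finset.prod_eq_zero (Finset.mem_univ i) (Set.indicator_of_notMem hi _)).symm

lemma likelihood_eq_prod_gaussDensity {N₀ : ℝ} {N : ℕ} (s : Fin N → ℂ) (u : ℝ × ℝ)
    (r : Fin N → ℂ) :
    likelihood N₀ s u r = ∏ n, gaussDensity N₀ (r n - gain u * s n) := by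
  unfold likelihood gaussDensity
  rw [Finset.prod_mul_distrib, Finset.prod_const, Finset.card_univ, Fintype.card_fin,
    ← Real.exp_sum, Finset.mul_sum, one_div_pow]

/-- The law of the observation vector of a single sensor. -/
def sensorLaw (c : Modulation) (Γ N₀ : ℝ) (N : ℕ) : Measure (Fin N → ℂ) :=
  ((Measure.pi fun _ : Fin N => c.symbolLaw).prod
    ((channelLaw Γ).prod (Measure.pi fun _ : Fin N => noiseLaw N₀))).map
    fun y n => gain y.2.1 * y.1 n + y.2.2 n

lemma isProbabilityMeasure_sensorLaw (c : Modulation) {Γ : ℝ} (hΓ : 0 < Γ) (N₀ : ℝ) (N : ℕ) :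
    IsProbabilityMeasure (sensorLaw c Γ N₀ N) := by
  have := isProbabilityMeasure_channelLaw hΓ
  unfold sensorLaw
  exact Measure.isProbabilityMeasure_map (Continuous.aemeasurable (by fun_prop))

/-- The marginal likelihood is the density of the observation vector of a single sensor. -/
lemma lintegral_sensorLaw (c : Modulation) {Γ N₀ : ℝ} (hΓ : 0 < Γ) (hN₀ : 0 < N₀) {N : ℕ}
    {f : (Fin N → ℂ) → ENNReal} (hf : Measurable f) :
    ∫⁻ r, f r ∂(sensorLaw c Γ N₀ N) =
      ∫⁻ r, f r * ENNReal.ofReal (marginalLikelihood c Γ N₀ r) := by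
  have := isProbabilityMeasure_channelLaw hΓ
  have hadd : Measurable fun y : (Fin N → ℂ) × (ℝ × ℝ) × (Fin N → ℂ) =>
      fun n => gain y.2.1 * y.1 n + y.2.2 n := Continuous.measurable (by fun_prop)
  have hfm : Measurable fun y : (Fin N → ℂ) × (ℝ × ℝ) × (Fin N → ℂ) =>
      f fun n => gain y.2.1 * y.1 n + y.2.2 n := hf.comp hadd
  have hinner : ∀ s : Fin N → ℂ,
      ∫⁻ y, f (fun n => gain y.1 * s n + y.2 n)
        ∂((channelLaw Γ).prod (Measure.pi fun _ : Fin N => noiseLaw N₀)) =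
      ∫⁻ r, f r * ENNReal.ofReal (∫ u, likelihood N₀ s u r ∂(channelLaw Γ)) := by
    intro s
    have hfs : Measurable fun y : (ℝ × ℝ) × (Fin N → ℂ) => f fun n => gain y.1 * s n + y.2 n :=
      hf.comp (Continuous.measurable (by fun_prop :
        Continuous fun (y : (ℝ × ℝ) × (Fin N → ℂ)) n => gain y.1 * s n + y.2 n))
    have hL : Continuous fun y : (ℝ × ℝ) × (Fin N → ℂ) => likelihood N₀ s y.1 y.2 := by
      unfold likelihood
      fun_prop
    rw [lintegral_prod _ hfs.aemeasurable]
    have hu : ∀ u : ℝ × ℝ,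
        ∫⁻ w, f (fun n => gain u * s n + w n) ∂(Measure.pi fun _ : Fin N => noiseLaw N₀) =
        ∫⁻ r, f r * ENNReal.ofReal (likelihood N₀ s u r) := by
      intro u
      have hfu : Measurable fun w : Fin N → ℂ => f fun n => gain u * s n + w n :=
        hf.comp (Continuous.measurable (by fun_prop :
          Continuous fun (w : Fin N → ℂ) n => gain u * s n + w n))
      have hd : Measurable fun w : Fin N → ℂ =>
          ENNReal.ofReal (∏ n, gaussDensity N₀ (w n)) := by fun_prop
      rw [pi_noiseLaw hN₀, lintegral_withDensity_eq_lintegral_mul _ hd hfu]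
      -- Translation invariance of Lebesgue measure replaces the noise `w` by the observation `r =
      -- gain u * s + w`.
      refine Eq.trans ?_ (lintegral_add_left_eq_self (μ := (volume : Measure (Fin N → ℂ)))
        (fun r => f r * ENNReal.ofReal (likelihood N₀ s u r)) fun n => gain u * s n)
      refine lintegral_congr fun w => ?_
      rw [likelihood_eq_prod_gaussDensity, Pi.mul_apply, mul_comm]
      simp only [Pi.add_apply, add_sub_cancel_left]
      rfl
    simp_rw [hu]
    rw [lintegral_lintegral_swap
      ((hf.comp measurable_snd).mul hL.measurable.ennreal_ofReal).aemeasurable]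
    refine lintegral_congr fun r => ?_
    have hr : Measurable fun u => ENNReal.ofReal (likelihood N₀ s u r) :=
      (continuous_likelihood_channel s r).measurable.ennreal_ofReal
    rw [lintegral_const_mul _ hr,
      ofReal_integral_eq_lintegral_ofReal (integrable_likelihood hΓ hN₀ s r)
      (.of_forall fun u => likelihood_nonneg hN₀ s u r)]
  have hI : ∀ s : Fin N → ℂ,
      Continuous fun r => ∫ u, likelihood N₀ s u r ∂(channelLaw Γ) := by
    intro s
    simp_rw [integral_likelihood hΓ hN₀]
    fun_prop
  rw [sensorLaw, lintegral_map hf hadd, lintegral_prod _ hfm.aemeasurable,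
    Modulation.lintegral_pi_symbolLaw]
  simp_rw [hinner]
  have hfI : ∀ s : Fin N → ℂ, Measurable fun r =>
      f r * ENNReal.ofReal (∫ u, likelihood N₀ s u r ∂(channelLaw Γ)) :=
    fun s => hf.mul (hI s).measurable.ennreal_ofReal
  rw [← lintegral_finsetSum _ fun s _ => hfI s,
    ← lintegral_const_mul _ (Finset.measurable_fun_sum _ fun s _ => hfI s)]
  refine lintegral_congr fun r => ?_
  have hpos := c.order_pos
  have hnn : ∀ s : Fin N → ℂ, 0 ≤ ∫ u, likelihood N₀ s u r ∂(channelLaw Γ) :=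
    fun s => integral_nonneg fun u => likelihood_nonneg hN₀ s u r
  unfold marginalLikelihood Modulation.symbolMean
  rw [integral_const_mul, integral_finsetSum _ fun s _ => integrable_likelihood hΓ hN₀ s r,
    ENNReal.ofReal_mul (by positivity), ENNReal.ofReal_sum_of_nonneg fun s _ => hnn s,
    ← Finset.mul_sum, one_div, ← inv_pow, ENNReal.ofReal_pow (by positivity),
    ENNReal.ofReal_inv_of_pos (by exact_mod_cast hpos), ENNReal.ofReal_natCast]
  ring

/-! ### Independence across sensors. -/

/-- Injectivity of the windows makes the symbols read by the sensors an i.i.d. `L × N` array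
although the transmitted sequence is shared. Regrouping symbols, gains and noise by sensor then
gives a product measure, and `received` acts on it coordinatewise. -/
lemma map_received_sampleLaw (c : Modulation) {Γ : ℝ} (hΓ : 0 < Γ) (N₀ : ℝ) {L N : ℕ}
    {win : Fin L → Fin N → ℕ} (hwin : Function.Injective fun p : Fin L × Fin N => win p.1 p.2) :
    (sampleLaw c Γ N₀ L N).map (received win) = Measure.pi fun _ : Fin L => sensorLaw c Γ N₀ N := by
  have := isProbabilityMeasure_channelLaw hΓ
  have hprob := isProbabilityMeasure_sensorLaw c hΓ N₀ N
  have hsym : (Measure.infinitePi fun _ : ℕ => c.symbolLaw).map (fun x l n => x (win l n)) =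
      Measure.pi fun _ : Fin L => Measure.pi fun _ : Fin N => c.symbolLaw := by
    have h1 := Measure.map_infinitePi_infinitePi_of_inj (P := fun _ : ℕ => c.symbolLaw) hwin
    have h2 := Measure.infinitePi_map_curry fun (_ : Fin L) (_ : Fin N) => c.symbolLaw
    simp_rw [Measure.infinitePi_eq_pi (ι := Fin N), Measure.infinitePi_eq_pi (ι := Fin L)] at h2
    rw [← h2, ← h1, Measure.map_map (by fun_prop) (by fun_prop)]
    rfl
  have hmp : MeasurePreserving (fun x l n => x (win l n))
      (Measure.infinitePi fun _ : ℕ => c.symbolLaw)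
      (Measure.pi fun _ : Fin L => Measure.pi fun _ : Fin N => c.symbolLaw) :=
    ⟨by fun_prop, hsym⟩
  -- Tuples of arrays become arrays of tuples, first for gain and noise, then with the symbols.
  have hzip := (measurePreserving_arrowProdEquivProdArrow (ℝ × ℝ) (Fin N → ℂ) (Fin L)
    (fun _ => channelLaw Γ) fun _ => Measure.pi fun _ : Fin N => noiseLaw N₀).symm
  have hzip' := (measurePreserving_arrowProdEquivProdArrow (Fin N → ℂ)
    ((ℝ × ℝ) × (Fin N → ℂ)) (Fin L) (fun _ => Measure.pi fun _ : Fin N => c.symbolLaw)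
    fun _ => (channelLaw Γ).prod (Measure.pi fun _ : Fin N => noiseLaw N₀)).symm
  have hall := hzip'.comp (hmp.prod hzip)
  have hadd : Measurable fun y : (Fin N → ℂ) × (ℝ × ℝ) × (Fin N → ℂ) =>
      fun n => gain y.2.1 * y.1 n + y.2.2 n := Continuous.measurable (by fun_prop)
  have hsf : SigmaFinite (sensorLaw c Γ N₀ N) := inferInstance
  unfold sensorLaw at hsf
  unfold sensorLaw
  refine Eq.trans ?_ (Measure.pi_map_pi (ι := Fin L)
    (μ := fun _ => (Measure.pi fun _ : Fin N => c.symbolLaw).prod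
      ((channelLaw Γ).prod (Measure.pi fun _ : Fin N => noiseLaw N₀)))
    (f := fun _ y n => gain y.2.1 * y.1 n + y.2.2 n) fun _ => hadd.aemeasurable)
  have hadd' : Measurable fun (x : Fin L → (Fin N → ℂ) × (ℝ × ℝ) × (Fin N → ℂ)) l n =>
      gain (x l).2.1 * (x l).1 n + (x l).2.2 n :=
    measurable_pi_lambda _ fun l => hadd.comp (measurable_pi_apply l)
  rw [← hall.map_eq, Measure.map_map hadd' hall.measurable]
  rfl

/-! ### Identifiability: different candidates have different closed forms. -/

/-- There are finitely many nodes, so any `φ` agrees on them with a Lagrange interpolation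
polynomial, and polynomials are combinations of moments. -/
lemma sum_mul_eq_of_forall_sum_mul_pow_eq {ι κ : Type*} {s : Finset ι} {t : Finset κ}
    {a y : ι → ℝ} {b z : κ → ℝ}
    (h : ∀ n : ℕ, ∑ i ∈ s, a i * y i ^ n = ∑ j ∈ t, b j * z j ^ n) (φ : ℝ → ℝ) :
    ∑ i ∈ s, a i * φ (y i) = ∑ j ∈ t, b j * φ (z j) := by
  classical
  set T : Finset ℝ := s.image y ∪ t.image z
  set P := Lagrange.interpolate T id φ
  have hP : ∀ x ∈ T, φ x = P.eval x := fun x hx =>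
    (Lagrange.eval_interpolate_at_node (v := id) φ (Set.injOn_id _) hx).symm
  have hs : ∀ i ∈ s, a i * φ (y i) = ∑ n ∈ Finset.range (P.natDegree + 1),
      P.coeff n * (a i * y i ^ n) := by
    intro i hi
    rw [hP _ (Finset.mem_union_left _ (Finset.mem_image_of_mem y hi)),
      Polynomial.eval_eq_sum_range, Finset.mul_sum]
    exact Finset.sum_congr rfl fun n _ => by ring
  have ht : ∀ j ∈ t, b j * φ (z j) = ∑ n ∈ Finset.range (P.natDegree + 1),
      P.coeff n * (b j * z j ^ n) := by
    intro j hj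
    rw [hP _ (Finset.mem_union_right _ (Finset.mem_image_of_mem z hj)),
      Polynomial.eval_eq_sum_range, Finset.mul_sum]
    exact Finset.sum_congr rfl fun n _ => by ring
  rw [Finset.sum_congr rfl hs, Finset.sum_congr rfl ht, Finset.sum_comm, Finset.sum_comm (s := t)]
  simp_rw [← Finset.mul_sum, h]

/-- The exponent by which the symbol vector `s` contributes to the closed form of the marginal
likelihood at `r`. -/
def correlation (Γ N₀ : ℝ) {N : ℕ} (s r : Fin N → ℂ) : ℝ :=
  Γ / N₀ ^ 2 * ‖∑ n, (starRingEnd ℂ) (s n) * r n‖ ^ 2 / (1 + Γ / N₀ * ∑ n, ‖s n‖ ^ 2)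

/-- Scaling by `√m` multiplies each correlation by `m`, so the sum is an `m`-th moment. -/
lemma closedForm_sqrt_mul (c : Modulation) (Γ N₀ : ℝ) {N : ℕ} (r : Fin N → ℂ) (m : ℕ) :
    closedForm c Γ N₀ (fun n => (Real.sqrt m : ℂ) * r n) =
      Real.exp (-(m * (∑ n, ‖r n‖ ^ 2) / N₀)) *
        ∑ s ∈ Fintype.piFinset (fun _ : Fin N => c.points),
          1 / (c.order : ℝ) ^ N * (1 / (1 + Γ / N₀ * ∑ n, ‖s n‖ ^ 2)) *
            Real.exp (correlation Γ N₀ s r) ^ m := by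
  have hm : ‖(Real.sqrt m : ℂ)‖ ^ 2 = m := by
    rw [Complex.norm_real, Real.norm_eq_abs, sq_abs, Real.sq_sqrt (Nat.cast_nonneg m)]
  unfold closedForm Modulation.symbolMean
  rw [Finset.mul_sum, Finset.mul_sum]
  refine Finset.sum_congr rfl fun s _ => ?_
  simp_rw [mul_left_comm _ (Real.sqrt m : ℂ), ← Finset.mul_sum, norm_mul, mul_pow, hm,
    ← Finset.mul_sum]
  rw [sub_eq_add_neg, Real.exp_add, ← Real.exp_nat_mul, correlation,
    show Γ / N₀ ^ 2 * (m * ‖∑ n, (starRingEnd ℂ) (s n) * r n‖ ^ 2) /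
      (1 + Γ / N₀ * ∑ n, ‖s n‖ ^ 2) = m * (Γ / N₀ ^ 2 * ‖∑ n, (starRingEnd ℂ) (s n) * r n‖ ^ 2 /
      (1 + Γ / N₀ * ∑ n, ‖s n‖ ^ 2)) by ring]
  ring

/-- The Gaussian factor in `‖r‖²` is common to both candidates and cancels, leaving equal moments at
the nodes `exp (correlation …)`; composing with `Real.log` returns to the correlations. -/
lemma sum_weight_correlation_eq {c d : Modulation} {Γ N₀ : ℝ} {N : ℕ}
    (h : ∀ r : Fin N → ℂ, closedForm c Γ N₀ r = closedForm d Γ N₀ r) (r : Fin N → ℂ)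
    (φ : ℝ → ℝ) :
    ∑ s ∈ Fintype.piFinset (fun _ : Fin N => c.points),
      1 / (c.order : ℝ) ^ N * (1 / (1 + Γ / N₀ * ∑ n, ‖s n‖ ^ 2)) * φ (correlation Γ N₀ s r) =
    ∑ s ∈ Fintype.piFinset (fun _ : Fin N => d.points),
      1 / (d.order : ℝ) ^ N * (1 / (1 + Γ / N₀ * ∑ n, ‖s n‖ ^ 2)) * φ (correlation Γ N₀ s r) := by
  have key := sum_mul_eq_of_forall_sum_mul_pow_eq
    (s := Fintype.piFinset fun _ : Fin N => c.points)
    (t := Fintype.piFinset fun _ : Fin N => d.points)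
    (a := fun s => 1 / (c.order : ℝ) ^ N * (1 / (1 + Γ / N₀ * ∑ n, ‖s n‖ ^ 2)))
    (b := fun s => 1 / (d.order : ℝ) ^ N * (1 / (1 + Γ / N₀ * ∑ n, ‖s n‖ ^ 2)))
    (y := fun s => Real.exp (correlation Γ N₀ s r))
    (z := fun s => Real.exp (correlation Γ N₀ s r))
    (fun m => by
      have hm := h fun n => (Real.sqrt m : ℂ) * r n
      rw [closedForm_sqrt_mul, closedForm_sqrt_mul] at hm
      exact mul_left_cancel₀ (Real.exp_ne_zero _) hm) (φ ∘ Real.log)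
  simpa only [Function.comp_apply, Real.log_exp] using key

/-- The components sum to `N` for every `x`, so that only the constant symbol vectors have a
correlation with this vector that stays bounded as `x` grows. -/
def probe (N : ℕ) (x : ℂ) (n : Fin N) : ℂ :=
  1 + x ^ ((n : ℕ) + 1) - (N : ℂ)⁻¹ * ∑ m : Fin N, x ^ ((m : ℕ) + 1)

lemma sum_probe {N : ℕ} (hN : 0 < N) (x : ℂ) : ∑ n, probe N x n = N := by
  have hN' : (N : ℂ) ≠ 0 := by exact_mod_cast hN.ne'
  simp only [probe, Finset.sum_sub_distrib, Finset.sum_add_distrib, Finset.sum_const,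
    Finset.card_univ, Fintype.card_fin, nsmul_eq_mul]
  field_simp
  ring

/-- The sum is a polynomial in `x` whose coefficient at `x ^ (k + 1)` is `s k` minus the mean of
`s`. For non-constant `s` one of these is nonzero; the shift to `k + 1` keeps them all in positive
degree. -/
lemma tendsto_norm_sum_mul_probe {N : ℕ} (hN : 0 < N) {s : Fin N → ℂ}
    (hs : ∃ k l, s k ≠ s l) :
    Tendsto (fun x : ℝ => ‖∑ n, s n * probe N x n‖) atTop atTop := by
  have hN' : (N : ℂ) ≠ 0 := by exact_mod_cast hN.ne'
  let p : Polynomial ℂ := ∑ n : Fin N, Polynomial.C (s n) * (1 + Polynomial.X ^ ((n : ℕ) + 1) -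
    Polynomial.C (N : ℂ)⁻¹ * ∑ m : Fin N, Polynomial.X ^ ((m : ℕ) + 1))
  have heval : ∀ x : ℂ, p.eval x = ∑ n, s n * probe N x n := by
    intro x
    simp [p, probe, Polynomial.eval_finsetSum]
  have hcoeff : ∀ k : Fin N, p.coeff ((k : ℕ) + 1) = s k - (N : ℂ)⁻¹ * ∑ n, s n := by
    intro k
    have hX : ∀ n : Fin N, (Polynomial.X ^ ((n : ℕ) + 1) : Polynomial ℂ).coeff ((k : ℕ) + 1) =
        if k = n then 1 else 0 := by
      intro n
      rw [Polynomial.coeff_X_pow]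
      simp [Fin.ext_iff]
    simp only [p, Polynomial.finsetSum_coeff, Polynomial.coeff_C_mul, Polynomial.coeff_sub,
      Polynomial.coeff_add, hX, Finset.sum_ite_eq, Finset.mem_univ, if_true, mul_sub, mul_add,
      mul_one, Finset.sum_sub_distrib, Finset.sum_add_distrib, mul_ite, mul_zero]
    simp [Finset.sum_mul, mul_comm]
  have hdeg : 0 < p.degree := by
    by_contra hp
    have hz : ∀ k : Fin N, s k = (N : ℂ)⁻¹ * ∑ n, s n := by
      intro k
      rw [← sub_eq_zero, ← hcoeff, Polynomial.eq_C_of_degree_le_zero (not_lt.1 hp),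
        Polynomial.coeff_C_succ]
    obtain ⟨k, l, hkl⟩ := hs
    exact hkl ((hz k).trans (hz l).symm)
  simp_rw [← heval]
  refine p.tendsto_norm_atTop hdeg ?_
  simp_rw [Complex.norm_real]
  exact tendsto_norm_atTop_atTop

/-- The value does not depend on `x`, determines `‖z‖`, and stays below `N / N₀`, the threshold
separating constant vectors from the others. -/
lemma correlation_const {Γ N₀ : ℝ} (hΓ : 0 < Γ) (hN₀ : 0 < N₀) {N : ℕ} (hN : 0 < N) (z x : ℂ) :
    correlation Γ N₀ (fun _ => z) (probe N x) =
      N / N₀ * (1 - 1 / (1 + Γ / N₀ * (N * ‖z‖ ^ 2))) := by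
  have hD : 0 < 1 + Γ / N₀ * (N * ‖z‖ ^ 2) := by positivity
  unfold correlation
  rw [← Finset.mul_sum, sum_probe hN, norm_mul, Complex.norm_natCast, RCLike.norm_conj,
    Finset.sum_const, Finset.card_univ, Fintype.card_fin, nsmul_eq_mul]
  field_simp
  ring

lemma eventually_correlation_gt {Γ N₀ : ℝ} (hΓ : 0 < Γ) (hN₀ : 0 < N₀) {N : ℕ} (hN : 0 < N)
    (B : ℝ) {s : Fin N → ℂ} (hs : ∃ k l, s k ≠ s l) :
    ∀ᶠ x : ℝ in atTop, B < correlation Γ N₀ s (probe N x) := by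
  have hX : 0 ≤ ∑ n, ‖s n‖ ^ 2 := Finset.sum_nonneg fun _ _ => by positivity
  have hD : 0 < 1 + Γ / N₀ * ∑ n, ‖s n‖ ^ 2 := by positivity
  have h1 := tendsto_norm_sum_mul_probe hN (s := fun n => (starRingEnd ℂ) (s n))
    (hs.imp fun k hk => hk.imp fun l hl => (starRingEnd ℂ).injective.ne hl)
  have h2 := ((tendsto_pow_atTop (two_ne_zero)).comp h1).const_mul_atTop
    (show 0 < Γ / N₀ ^ 2 by positivity)
  have h3 := h2.atTop_div_const hD
  exact h3.eventually_gt_atTop B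

/-- The scaled law of the symbol energy can be read off the marginal likelihood. -/
lemma sum_energy_eq {c d : Modulation} {Γ N₀ : ℝ} (hΓ : 0 < Γ) (hN₀ : 0 < N₀) {N : ℕ}
    (hN : 0 < N) (h : ∀ r : Fin N → ℂ, closedForm c Γ N₀ r = closedForm d Γ N₀ r) (ψ : ℝ → ℝ) :
    1 / (c.order : ℝ) ^ N * ∑ z ∈ c.points, ψ (‖z‖ ^ 2) =
      1 / (d.order : ℝ) ^ N * ∑ z ∈ d.points, ψ (‖z‖ ^ 2) := by
  classical
  have hNr : (0 : ℝ) < N := by exact_mod_cast hN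
  -- At the correlation of a constant vector `z`, `g` recovers `D = 1 + Γ / N₀ * (N * ‖z‖ ^ 2)`. In
  -- `φ` the factor `g v` cancels the weight `1 / D`, the argument of `ψ` becomes `‖z‖ ^ 2`, and the
  -- cutoff discards non-constant vectors.
  let g : ℝ → ℝ := fun v => 1 / (1 - N₀ / N * v)
  let φ : ℝ → ℝ := fun v => if v < N / N₀ then g v * ψ ((g v - 1) * (N₀ / (Γ * N))) else 0
  -- There are finitely many symbol vectors, so one `x` serves both constellations.
  have hev : ∀ᶠ x : ℝ in atTop,
      ∀ s ∈ Fintype.piFinset (fun _ : Fin N => c.points ∪ d.points), (∃ k l, s k ≠ s l) →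
        N / N₀ < correlation Γ N₀ s (probe N x) := by
    rw [Filter.eventually_all_finset]
    intro s _
    by_cases hs : ∃ k l, s k ≠ s l
    · filter_upwards [eventually_correlation_gt hΓ hN₀ hN (N / N₀) hs] with x hx _ using hx
    · exact .of_forall fun x hs' => absurd hs' hs
  obtain ⟨x, hx⟩ := hev.exists
  have hsum : ∀ e : Modulation, e.points ⊆ c.points ∪ d.points →
      ∑ s ∈ Fintype.piFinset (fun _ : Fin N => e.points),
        1 / (e.order : ℝ) ^ N * (1 / (1 + Γ / N₀ * ∑ n, ‖s n‖ ^ 2)) *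
          φ (correlation Γ N₀ s (probe N x)) =
      1 / (e.order : ℝ) ^ N * ∑ z ∈ e.points, ψ (‖z‖ ^ 2) := by
    intro e he
    have hinj : Function.Injective fun (z : ℂ) (_ : Fin N) => z :=
      fun z w hzw => congr_fun hzw ⟨0, hN⟩
    rw [← Finset.sum_subset (s₁ := e.points.image fun (z : ℂ) (_ : Fin N) => z),
      Finset.sum_image fun z _ w _ hzw => hinj hzw, Finset.mul_sum]
    · refine Finset.sum_congr rfl fun z _ => ?_
      have hD : 0 < 1 + Γ / N₀ * (N * ‖z‖ ^ 2) := by positivity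
      have hlt : N / N₀ * (1 - 1 / (1 + Γ / N₀ * (N * ‖z‖ ^ 2))) < N / N₀ := by
        have : 0 < N / N₀ := by positivity
        have h1 : 0 < 1 / (1 + Γ / N₀ * (N * ‖z‖ ^ 2)) := by positivity
        nlinarith
      have hg : g (N / N₀ * (1 - 1 / (1 + Γ / N₀ * (N * ‖z‖ ^ 2)))) =
          1 + Γ / N₀ * (N * ‖z‖ ^ 2) := by
        simp only [g]
        rw [← mul_assoc, show N₀ / N * (N / N₀) = 1 by field_simp, one_mul, sub_sub_cancel,
          one_div_one_div]
      simp only [correlation_const hΓ hN₀ hN, φ, if_pos hlt, hg, Finset.sum_const,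
        Finset.card_univ, Fintype.card_fin, nsmul_eq_mul]
      rw [show (1 + Γ / N₀ * (N * ‖z‖ ^ 2) - 1) * (N₀ / (Γ * N)) = ‖z‖ ^ 2 by field_simp; ring]
      field_simp
    · intro s hs
      obtain ⟨z, hz, rfl⟩ := Finset.mem_image.1 hs
      exact Fintype.mem_piFinset.2 fun _ => hz
    · intro s hs hs'
      have hne : ∃ k l, s k ≠ s l := by
        by_contra! hc
        exact hs' (Finset.mem_image.2 ⟨s ⟨0, hN⟩, Fintype.mem_piFinset.1 hs _,
          funext fun n => hc _ _⟩)
      have := hx s (Fintype.mem_piFinset.2 fun n => he (Fintype.mem_piFinset.1 hs n)) hne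
      simp only [φ, if_neg this.not_gt, mul_zero]
  rw [← hsum c Finset.subset_union_left, ← hsum d Finset.subset_union_right]
  exact sum_weight_correlation_eq h _ φ

/-- With `ψ = 1` the invariant is `M ^ (1 - N)`, which determines `M` only because `N > 1`. -/
lemma order_eq_of_closedForm_eq {c d : Modulation} {Γ N₀ : ℝ} (hΓ : 0 < Γ) (hN₀ : 0 < N₀)
    {N : ℕ} (hN : 1 < N) (h : ∀ r : Fin N → ℂ, closedForm c Γ N₀ r = closedForm d Γ N₀ r) :
    c.order = d.order := by
  have h1 := sum_energy_eq hΓ hN₀ (zero_lt_one.trans hN) h fun _ => 1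
  obtain ⟨k, rfl⟩ : ∃ k, N = k + 1 := ⟨N - 1, by omega⟩
  have hc : (c.order : ℝ) ≠ 0 := by exact_mod_cast c.order_pos.ne'
  have hd : (d.order : ℝ) ≠ 0 := by exact_mod_cast d.order_pos.ne'
  have hk : ∀ M : ℝ, M ≠ 0 → 1 / M ^ (k + 1) * M = (M ^ k)⁻¹ := by
    intro M hM
    rw [pow_succ]
    field_simp
  simp only [Finset.sum_const, nsmul_eq_mul, mul_one] at h1
  change 1 / (c.order : ℝ) ^ (k + 1) * (c.order : ℝ) =
    1 / (d.order : ℝ) ^ (k + 1) * (d.order : ℝ) at h1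
  rw [hk _ hc, hk _ hd, inv_inj] at h1
  exact Nat.pow_left_injective (show k ≠ 0 by omega) (by exact_mod_cast h1)

lemma Modulation.norm_eq_one_of_psk {c : Modulation} (hc : c.family = Family.psk) {z : ℂ}
    (hz : z ∈ c.points) : ‖z‖ = 1 := by
  have h := c.shape
  rw [hc] at h
  obtain ⟨φ, hφ⟩ := h
  obtain ⟨m, -, rfl⟩ := (hφ z).1 hz
  exact Complex.norm_exp_ofReal_mul_I _

lemma Modulation.exists_norm_ne_one_of_qam {c : Modulation} (hc : c.family = Family.qam) :
    ∃ z ∈ c.points, ‖z‖ ≠ 1 := by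
  have h := c.shape
  rw [hc] at h
  obtain ⟨z, hz, w, hw, hzw⟩ := h
  by_contra! hall
  exact hzw ((hall z hz).trans (hall w hw).symm)

/-- The test function `(v - 1) ^ 2` of the energy vanishes on the unit circle, whereas a
constellation with two amplitudes has a point off it. -/
lemma closedForm_psk_ne_qam {c d : Modulation} {Γ N₀ : ℝ} (hΓ : 0 < Γ) (hN₀ : 0 < N₀)
    {N : ℕ} (hN : 0 < N) (hc : c.family = Family.psk) (hd : d.family = Family.qam) :
    ∃ r : Fin N → ℂ, closedForm c Γ N₀ r ≠ closedForm d Γ N₀ r := by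
  by_contra! h
  have h1 := sum_energy_eq hΓ hN₀ hN h fun v => (v - 1) ^ 2
  rw [Finset.sum_eq_zero fun z hz => by simp [Modulation.norm_eq_one_of_psk hc hz], mul_zero]
    at h1
  obtain ⟨z, hz, hz1⟩ := Modulation.exists_norm_ne_one_of_qam hd
  have hpos : 0 < ∑ z ∈ d.points, (‖z‖ ^ 2 - 1) ^ 2 := by
    refine Finset.sum_pos' (fun _ _ => sq_nonneg _) ⟨z, hz, sq_pos_of_ne_zero ?_⟩
    intro h0
    exact hz1 ((pow_eq_one_iff_of_nonneg (norm_nonneg z) two_ne_zero).1 (sub_eq_zero.1 h0))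
  have hd0 : 0 < (d.order : ℝ) := by exact_mod_cast d.order_pos
  exact (mul_pos (by positivity) hpos).ne h1

/-- Candidates that differ in family or order have different marginal likelihoods. -/
lemma exists_closedForm_ne {c d : Modulation} (hcd : c.family ≠ d.family ∨ c.order ≠ d.order)
    {Γ N₀ : ℝ} (hΓ : 0 < Γ) (hN₀ : 0 < N₀) {N : ℕ} (hN : 1 < N) :
    ∃ r : Fin N → ℂ, closedForm c Γ N₀ r ≠ closedForm d Γ N₀ r := by
  rcases hcd with hf | ho
  · rcases hc : c.family with _ | _ <;> rcases hd : d.family with _ | _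
    · exact absurd (hc.trans hd.symm) hf
    · exact closedForm_psk_ne_qam hΓ hN₀ (zero_lt_one.trans hN) hc hd
    · obtain ⟨r, hr⟩ := closedForm_psk_ne_qam hΓ hN₀ (zero_lt_one.trans hN) hd hc
      exact ⟨r, hr.symm⟩
    · exact absurd (hc.trans hd.symm) hf
  · by_contra! h
    exact ho (order_eq_of_closedForm_eq hΓ hN₀ hN h)

/-! ### Bhattacharyya coefficient and Chernoff bound. -/

lemma closedForm_pos (c : Modulation) {Γ N₀ : ℝ} (hΓ : 0 < Γ) (hN₀ : 0 < N₀) {N : ℕ}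
    (r : Fin N → ℂ) : 0 < closedForm c Γ N₀ r := by
  have hc : (0 : ℝ) < c.order := by exact_mod_cast c.order_pos
  refine mul_pos (by positivity) (Finset.sum_pos (fun s _ => ?_)
    (Fintype.piFinset_nonempty.2 fun _ => c.points_nonempty))
  have hX : 0 ≤ ∑ n, ‖s n‖ ^ 2 := Finset.sum_nonneg fun _ _ => by positivity
  positivity

lemma marginalLikelihood_pos (c : Modulation) {Γ N₀ : ℝ} (hΓ : 0 < Γ) (hN₀ : 0 < N₀) {N : ℕ}
    (r : Fin N → ℂ) : 0 < marginalLikelihood c Γ N₀ r := by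
  have hpi := Real.pi_pos
  have := closedForm_pos c hΓ hN₀ r
  rw [marginalLikelihood_eq c hΓ hN₀]
  positivity

lemma continuous_marginalLikelihood (c : Modulation) {Γ N₀ : ℝ} (hΓ : 0 < Γ) (hN₀ : 0 < N₀)
    {N : ℕ} : Continuous fun r : Fin N → ℂ => marginalLikelihood c Γ N₀ r := by
  simp_rw [marginalLikelihood_eq c hΓ hN₀]
  unfold closedForm Modulation.symbolMean
  fun_prop

lemma lintegral_marginalLikelihood (c : Modulation) {Γ N₀ : ℝ} (hΓ : 0 < Γ) (hN₀ : 0 < N₀)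
    (N : ℕ) : ∫⁻ r : Fin N → ℂ, ENNReal.ofReal (marginalLikelihood c Γ N₀ r) = 1 := by
  have := isProbabilityMeasure_sensorLaw c hΓ N₀ N
  have h := lintegral_sensorLaw c hΓ hN₀ (measurable_one (α := ENNReal) (β := Fin N → ℂ))
  simpa using h.symm

/-- The Bhattacharyya coefficient of the laws of an observation vector under two candidates. -/
def bhattacharyya (c d : Modulation) (Γ N₀ : ℝ) (N : ℕ) : ENNReal :=
  ∫⁻ r : Fin N → ℂ,
    ENNReal.ofReal (Real.sqrt (marginalLikelihood c Γ N₀ r * marginalLikelihood d Γ N₀ r))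

/-- The geometric mean of the densities is at most their arithmetic mean, which integrates to 1. The
inequality is strict where they differ, a nonempty open set and so one of positive measure. -/
lemma bhattacharyya_lt_one {c d : Modulation} (hcd : c.family ≠ d.family ∨ c.order ≠ d.order)
    {Γ N₀ : ℝ} (hΓ : 0 < Γ) (hN₀ : 0 < N₀) {N : ℕ} (hN : 1 < N) :
    bhattacharyya c d Γ N₀ N < 1 := by
  have hpi := Real.pi_pos
  have hp := marginalLikelihood_pos c hΓ hN₀ (N := N)
  have hq := marginalLikelihood_pos d hΓ hN₀ (N := N)
  have hpc := continuous_marginalLikelihood c hΓ hN₀ (N := N)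
  have hqc := continuous_marginalLikelihood d hΓ hN₀ (N := N)
  set p : (Fin N → ℂ) → ℝ := fun r => marginalLikelihood c Γ N₀ r
  set q : (Fin N → ℂ) → ℝ := fun r => marginalLikelihood d Γ N₀ r
  have hmean : ∫⁻ r, ENNReal.ofReal ((p r + q r) / 2) = 1 := by
    have h1 : ∀ r, ENNReal.ofReal ((p r + q r) / 2) =
        ENNReal.ofReal (1 / 2) * (ENNReal.ofReal (p r) + ENNReal.ofReal (q r)) := by
      intro r
      rw [← ENNReal.ofReal_add (hp r).le (hq r).le, ← ENNReal.ofReal_mul (by norm_num)]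
      congr 1
      ring
    simp_rw [h1]
    rw [lintegral_const_mul _ (by fun_prop), lintegral_add_left (by fun_prop),
      lintegral_marginalLikelihood c hΓ hN₀, lintegral_marginalLikelihood d hΓ hN₀,
      one_add_one_eq_two, ← ENNReal.ofReal_ofNat 2, ← ENNReal.ofReal_mul (by norm_num)]
    norm_num
  have hle : ∀ r, Real.sqrt (p r * q r) ≤ (p r + q r) / 2 := by
    intro r
    have := hp r
    have := hq r
    exact Real.sqrt_le_iff.2 ⟨by linarith, by nlinarith [sq_nonneg (p r - q r)]⟩
  have hlt : ∀ r, p r ≠ q r → Real.sqrt (p r * q r) < (p r + q r) / 2 := by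
    intro r hr
    have h1 := hp r
    have h2 := hq r
    exact (Real.sqrt_lt' (by linarith)).2 (by nlinarith [sq_pos_of_ne_zero (sub_ne_zero.2 hr)])
  have hopen : IsOpen {r | p r ≠ q r} := isOpen_ne_fun hpc hqc
  have hne : {r | p r ≠ q r}.Nonempty := by
    obtain ⟨r, hr⟩ := exists_closedForm_ne hcd hΓ hN₀ hN
    refine ⟨r, fun h => hr ?_⟩
    simp only [p, q, marginalLikelihood_eq _ hΓ hN₀] at h
    exact mul_left_cancel₀ (by positivity) h
  rw [← hmean]
  have hmono : ∀ r, ENNReal.ofReal (Real.sqrt (p r * q r)) ≤ ENNReal.ofReal ((p r + q r) / 2) :=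
    fun r => ENNReal.ofReal_le_ofReal (hle r)
  refine lintegral_strict_mono_of_ae_le_of_ae_lt_on (by fun_prop)
    ((lintegral_mono hmono).trans_lt (hmean ▸ ENNReal.one_lt_top)).ne (.of_forall hmono)
    (hopen.measure_pos volume hne).ne' (.of_forall fun r hr => ?_)
  have h1 := hp r
  have h2 := hq r
  exact (ENNReal.ofReal_lt_ofReal_iff (by linarith)).2 (hlt r hr)

/-- Turns the error event into a threshold event for a product over sensors, ready for Markov's
inequality. -/
lemma one_le_prod_sqrt_of_fusionStatistic_le {c d : Modulation} {Γ N₀ : ℝ} (hΓ : 0 < Γ)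
    (hN₀ : 0 < N₀) {L N : ℕ} (hL : 0 < L) {r : Fin L → Fin N → ℂ}
    (h : fusionStatistic d Γ N₀ r ≤ fusionStatistic c Γ N₀ r) :
    1 ≤ ∏ l, Real.sqrt (marginalLikelihood d Γ N₀ (r l) / marginalLikelihood c Γ N₀ (r l)) := by
  have hp := fun l => marginalLikelihood_pos c hΓ hN₀ (r l)
  have hq := fun l => marginalLikelihood_pos d hΓ hN₀ (r l)
  have hP : 0 < ∏ l, marginalLikelihood c Γ N₀ (r l) := Finset.prod_pos fun l _ => hp l
  have hQ : 0 < ∏ l, marginalLikelihood d Γ N₀ (r l) := Finset.prod_pos fun l _ => hq l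
  have hLr : (0 : ℝ) < 1 / L := by
    have : (0 : ℝ) < L := by exact_mod_cast hL
    positivity
  unfold fusionStatistic at h
  have hlog := (mul_le_mul_iff_right₀ hLr).1 (by linarith :
    1 / (L : ℝ) * Real.log (∏ l, marginalLikelihood c Γ N₀ (r l)) ≤
      1 / (L : ℝ) * Real.log (∏ l, marginalLikelihood d Γ N₀ (r l)))
  have hle := (Real.log_le_log_iff hP hQ).1 hlog
  refine (one_le_sq_iff₀ (Finset.prod_nonneg fun _ _ => Real.sqrt_nonneg _)).1 ?_
  rw [← Finset.prod_pow, Finset.prod_congr rfl fun l _ => Real.sq_sqrt (div_pos (hq l) (hp l)).le,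
    Finset.prod_div_distrib]
  exact (one_le_div hP).2 hle

/-- Chernoff bound for the error event in favour of a competing candidate. -/
lemma sampleLaw_fusionStatistic_le (c d : Modulation) {Γ N₀ : ℝ} (hΓ : 0 < Γ) (hN₀ : 0 < N₀)
    {L N : ℕ} (hL : 0 < L) {win : Fin L → Fin N → ℕ}
    (hwin : Function.Injective fun p : Fin L × Fin N => win p.1 p.2) :
    sampleLaw c Γ N₀ L N {x | fusionStatistic d Γ N₀ (received win x) ≤
      fusionStatistic c Γ N₀ (received win x)} ≤ bhattacharyya c d Γ N₀ N ^ L := by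
  have := isProbabilityMeasure_sensorLaw c hΓ N₀ N
  have hpc := continuous_marginalLikelihood c hΓ hN₀ (N := N)
  have hqc := continuous_marginalLikelihood d hΓ hN₀ (N := N)
  have hrec : Measurable (received (L := L) (N := N) win) := by
    refine Continuous.measurable ?_
    unfold received
    fun_prop
  let f : (Fin N → ℂ) → ENNReal := fun r =>
    ENNReal.ofReal (Real.sqrt (marginalLikelihood d Γ N₀ r / marginalLikelihood c Γ N₀ r))
  have hf : Measurable f :=
    ((hqc.measurable.div hpc.measurable).sqrt).ennreal_ofReal
  have hF : Measurable fun r : Fin L → Fin N → ℂ => ∏ l, f (r l) :=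
    Finset.measurable_fun_prod _ fun l _ => hf.comp (measurable_pi_apply l)
  have hint : ∫⁻ r, f r ∂(sensorLaw c Γ N₀ N) = bhattacharyya c d Γ N₀ N := by
    rw [lintegral_sensorLaw c hΓ hN₀ hf, bhattacharyya]
    refine lintegral_congr fun r => ?_
    have hp := marginalLikelihood_pos c hΓ hN₀ r
    simp only [f]
    rw [← ENNReal.ofReal_mul (Real.sqrt_nonneg _)]
    congr 1
    -- Writing `p = √(p²)` gives `√(q / p) * p = √(p * q)`.
    nth_rw 2 [← Real.sqrt_sq hp.le]
    rw [← Real.sqrt_mul' _ (sq_nonneg _)]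
    congr 1
    field_simp
  calc sampleLaw c Γ N₀ L N {x | fusionStatistic d Γ N₀ (received win x) ≤
        fusionStatistic c Γ N₀ (received win x)}
      ≤ sampleLaw c Γ N₀ L N (received win ⁻¹' {r | 1 ≤ ∏ l, f (r l)}) := by
        refine measure_mono fun x hx => ?_
        have h1 := one_le_prod_sqrt_of_fusionStatistic_le hΓ hN₀ hL hx
        simp only [Set.mem_preimage, Set.mem_ofPred_eq, f]
        rw [← ENNReal.ofReal_prod_of_nonneg fun _ _ => Real.sqrt_nonneg _]
        exact ENNReal.one_le_ofReal.2 h1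
    _ = Measure.pi (fun _ : Fin L => sensorLaw c Γ N₀ N) {r | 1 ≤ ∏ l, f (r l)} := by
        rw [← map_received_sampleLaw c hΓ N₀ hwin,
          Measure.map_apply hrec (measurableSet_le measurable_const hF)]
    _ ≤ ∫⁻ r, ∏ l, f (r l) ∂(Measure.pi fun _ : Fin L => sensorLaw c Γ N₀ N) := by
        simpa using mul_meas_ge_le_lintegral hF 1
    _ = bhattacharyya c d Γ N₀ N ^ L := by
        rw [lintegral_pi_prod_eq_prod _ (fun _ => f) fun _ => hf]
        simp [hint]

/-! ### Union bound and convergence of the error probability. -/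

lemma isProbabilityMeasure_sampleLaw (c : Modulation) {Γ : ℝ} (hΓ : 0 < Γ) (N₀ : ℝ) (L N : ℕ) :
    IsProbabilityMeasure (sampleLaw c Γ N₀ L N) := by
  have := isProbabilityMeasure_channelLaw hΓ
  unfold sampleLaw
  infer_instance

lemma condErrorProb_nonneg {S : ℕ} (c : Fin S → Modulation) {Γ : ℝ} (hΓ : 0 < Γ) (N₀ : ℝ)
    {L N : ℕ} (win : Fin L → Fin N → ℕ) (i : Fin S) : 0 ≤ condErrorProb c Γ N₀ win i := by
  have := isProbabilityMeasure_sampleLaw (c i) hΓ N₀ L N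
  exact sub_nonneg.2 measureReal_le_one

lemma condErrorProb_le {S : ℕ} (c : Fin S → Modulation) {Γ N₀ : ℝ} (hΓ : 0 < Γ) (hN₀ : 0 < N₀)
    (hc : ∀ i j, i ≠ j → (c i).family ≠ (c j).family ∨ (c i).order ≠ (c j).order)
    {L N : ℕ} (hN : 1 < N) (hL : 0 < L) {win : Fin L → Fin N → ℕ}
    (hwin : Function.Injective fun p : Fin L × Fin N => win p.1 p.2) (i : Fin S) :
    condErrorProb c Γ N₀ win i ≤
      ∑ j ∈ Finset.univ.erase i, (bhattacharyya (c i) (c j) Γ N₀ N).toReal ^ L := by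
  have := isProbabilityMeasure_sampleLaw (c i) hΓ N₀ L N
  set μ := sampleLaw (c i) Γ N₀ L N
  let E : Fin S → Set (Sample L N) := fun j =>
    {x | fusionStatistic (c j) Γ N₀ (received win x) ≤ fusionStatistic (c i) Γ N₀ (received win x)}
  -- Ties belong to the events `E j`. Covering the whole space, rather than taking a complement,
  -- avoids proving that the decision event is measurable.
  have hcover : (Set.univ : Set (Sample L N)) ⊆
      {x | received win x ∈ decides c Γ N₀ i} ∪ ⋃ j ∈ Finset.univ.erase i, E j := by
    intro x _
    by_cases hx : received win x ∈ decides c Γ N₀ i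
    · exact Or.inl hx
    · simp only [decides, Set.mem_ofPred_eq, not_forall, not_lt] at hx
      obtain ⟨j, hj, hle⟩ := hx
      exact Or.inr (Set.mem_biUnion (Finset.mem_erase.2 ⟨hj, Finset.mem_univ j⟩) hle)
  have h1 : (1 : ℝ) ≤ μ.real {x | received win x ∈ decides c Γ N₀ i} +
      ∑ j ∈ Finset.univ.erase i, μ.real (E j) := by
    calc (1 : ℝ) = μ.real Set.univ := by simp
      _ ≤ _ := measureReal_mono hcover
      _ ≤ _ := measureReal_union_le _ _
      _ ≤ _ := by
        gcongr
        exact measureReal_biUnion_finset_le _ _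
  have h2 : ∀ j ∈ Finset.univ.erase i,
      μ.real (E j) ≤ (bhattacharyya (c i) (c j) Γ N₀ N).toReal ^ L := by
    intro j hj
    have hb := bhattacharyya_lt_one (hc i j (Finset.ne_of_mem_erase hj).symm) hΓ hN₀ hN
    rw [← ENNReal.toReal_pow]
    exact ENNReal.toReal_mono (ENNReal.pow_ne_top (hb.trans ENNReal.one_lt_top).ne)
      (sampleLaw_fusionStatistic_le (c i) (c j) hΓ hN₀ hL hwin)
  have h3 := Finset.sum_le_sum h2
  unfold condErrorProb
  linarith

lemma tendsto_condErrorProb {S : ℕ} (c : Fin S → Modulation) {Γ N₀ : ℝ} (hΓ : 0 < Γ)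
    (hN₀ : 0 < N₀)
    (hc : ∀ i j, i ≠ j → (c i).family ≠ (c j).family ∨ (c i).order ≠ (c j).order)
    {N : ℕ} (hN : 1 < N) {win : (L : ℕ) → Fin L → Fin N → ℕ}
    (hwin : ∀ L, Function.Injective (fun p : Fin L × Fin N => win L p.1 p.2)) (i : Fin S) :
    Tendsto (fun L : ℕ => condErrorProb c Γ N₀ (win L) i) atTop (𝓝 0) := by
  have hlim : Tendsto (fun L : ℕ =>
      ∑ j ∈ Finset.univ.erase i, (bhattacharyya (c i) (c j) Γ N₀ N).toReal ^ L) atTop (𝓝 0) := by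
    rw [← Finset.sum_const_zero (s := Finset.univ.erase i)]
    refine tendsto_finsetSum _ fun j hj => ?_
    have hb := bhattacharyya_lt_one (hc i j (Finset.ne_of_mem_erase hj).symm) hΓ hN₀ hN
    refine tendsto_pow_atTop_nhds_zero_of_lt_one ENNReal.toReal_nonneg ?_
    simpa using (ENNReal.toReal_lt_toReal (hb.trans ENNReal.one_lt_top).ne ENNReal.one_ne_top).2 hb
  refine tendsto_of_tendsto_of_tendsto_of_le_of_le' tendsto_const_nhds hlim
    (.of_forall fun L => condErrorProb_nonneg c hΓ N₀ (win L) i) ?_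
  filter_upwards [eventually_gt_atTop 0] with L hL
  exact condErrorProb_le c hΓ hN₀ hc hN hL (hwin L) i

end ModClass

end

theorem theorem4 {S : ℕ} (c : Fin S → ModClass.Modulation)
    (hc : ∀ i j, i ≠ j → (c i).family ≠ (c j).family ∨ (c i).order ≠ (c j).order)
    (Γ N₀ : ℝ) (hΓ : 0 < Γ) (hN₀ : 0 < N₀)
    (N : ℕ) (hN : 1 < N)
    (win : (L : ℕ) → Fin L → Fin N → ℕ)
    (hwin : ∀ L, Function.Injective (fun p : Fin L × Fin N => win L p.1 p.2)) :
    (∀ i, ∀ r : Fin N → ℂ, ModClass.marginalLikelihood (c i) Γ N₀ r =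
      1 / (Real.pi * N₀) ^ N * ModClass.closedForm (c i) Γ N₀ r) ∧
    Tendsto (fun L : ℕ => ModClass.errorProb c Γ N₀ (win L)) atTop (𝓝 0) := by
  refine ⟨fun i r => ModClass.marginalLikelihood_eq (c i) hΓ hN₀ r, ?_⟩
  have h := tendsto_finsetSum Finset.univ fun i _ =>
    ModClass.tendsto_condErrorProb c hΓ hN₀ hc hN hwin i
  simpa [ModClass.errorProb] using h.const_mul (1 / (S : ℝ))
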